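/- Let $F$ be a nonarchimedean local field with ring of integers $\mathfrak{o}_F$ and residue field of order $q$, and let $\Gamma$ be a torsion-free discrete subgroup of $PGL(2,F)$ such that $\Gamma\backslash PGL(2,F)$ is compact. Then $\Gamma$ is a free group of finite rank. Let $n$ be the number of its free generators. If Haar measure on $PGL(2,F)$ is normalized so that $\mathrm{vol}(PGL(2,\mathfrak{o}_F))=\frac{1}{2}(q-1)$, where $PGL(2,\mathfrak{o}_F)$ is regarded as a subgroup of $PGL(2,F)$, then $$\mathrm{vol}(\Gamma\backslash PGL(2,F)) = n-1.$$ Here $\mathrm{vol}(\Gamma\backslash PGL(2,F))$ is the measure of a fundamental domain for the left translation action of $\Gamma$ on $PGL(2,F)$ (such a domain exists, and its measure does not depend on the choice). -/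

import Mathlib

open scoped MatrixGroups Valued ValuativeRel ENNReal

/-- The topology on `PGL(2, R)`: the quotient topology from `GL(2, R)`, which carries the
topology of the unit group of the topological ring of matrices. -/
instance pgl2TopologicalSpace (R : Type*) [CommRing R] [TopologicalSpace R] :
    TopologicalSpace PGL(2, R) :=
  inferInstanceAs (TopologicalSpace (GL (Fin 2) R ⧸ Subgroup.center (GL (Fin 2) R)))

/-- `PGL(2, 𝒪_F)` as a subgroup of `PGL(2, F)`: the image of the natural homomorphism
`PGL(2, 𝒪_F) → PGL(2, F)` induced by the inclusion of the ring of integers. -/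
noncomputable def pgl2Integers (F : Type*) [Field F] [ValuativeRel F] : Subgroup PGL(2, F) :=
  (Matrix.ProjGenLinGroup.map (n := Fin 2) (algebraMap 𝒪[F] F)).range

-- Write `G = PGL(2, F)` and `K = PGL(2, 𝒪_F)`. The cosets `G / K` are the vertices of a `(q +
-- 1)`-regular tree on which `G` acts. As `K` is compact, a vertex stabilizer in `Γ` is discrete and
-- compact, hence finite, hence trivial; as `K` is open and `Γ \ G` compact, the set `R` of vertex
-- orbits is finite. So `Γ` acts freely on the vertices, which become `Γ × R`.
--
-- The groupoid with object set `R` and all hom-sets `Γ` is free on the oriented edges modulo `Γ`: a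
-- labelling of edges extends uniquely to a cocycle by multiplying along paths
-- (`existsUnique_cocycle`). A vertex group of a connected free groupoid is free, so `Γ` is free.
-- For the rank, count cocycles with values in a group of order 2 in two ways (`card_pos_eq`): with
-- `E` edge orbits and rank `n`, `2 ^ E = 2 ^ n * 2 ^ (|R| - 1)`. Regularity gives `2 * E = |R| * (q
-- + 1)`, hence `|R| * (q - 1) / 2 = n - 1`.
--
-- One coset of `K` for each orbit makes up a fundamental domain, of measure `|R| * μ K = |R| * (q -
-- 1) / 2`.
--
-- The tree property comes from the Cartan decomposition: the level of a vertex is its elementary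
-- divisor exponent, and a neighbour that is not one level further out is the parent
-- (`eq_treeParent_or_level_eq`).

universe u v

/-! ### Equivariant trees and cocycles -/

/-- A tree with vertex set `Γ × R`, on which `Γ` acts by left multiplication on the first factor.
The edges are recorded by `Adj r γ s`, which says that `(γ, r)` is adjacent to `(1, s)`. The tree
property is expressed by a root and a parent function. -/
structure EquivariantTree (Γ R : Type u) [Group Γ] where
  Adj : R → Γ → R → Prop
  symm : ∀ {r γ s}, Adj r γ s → Adj s γ⁻¹ r
  root : Γ × R
  level : Γ × R → ℕ
  parent : Γ × R → Γ × R
  level_parent : ∀ v, v ≠ root → level (parent v) < level v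
  adj_parent : ∀ v, v ≠ root → Adj v.2 ((parent v).1⁻¹ * v.1) (parent v).2
  eq_parent : ∀ v w : Γ × R, Adj v.2 (w.1⁻¹ * v.1) w.2 →
    (v ≠ root ∧ w = parent v) ∨ (w ≠ root ∧ v = parent w)

/-- A family of elements of `X` indexed by the arrows of the groupoid with objects `R` and all
hom-sets equal to `Γ`, compatible with composition. -/
def IsOrbitCocycle {Γ R X : Type*} [Group Γ] [Group X] (c : R → Γ → R → X) : Prop :=
  ∀ r γ s δ t, c r (δ * γ) t = c s δ t * c r γ s

namespace IsOrbitCocycle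

variable {Γ R X : Type*} [Group Γ] [Group X] {c : R → Γ → R → X}

theorem map_one (hc : IsOrbitCocycle c) (r : R) : c r 1 r = 1 := by
  have := hc r 1 r 1 r
  simpa using this

theorem map_inv (hc : IsOrbitCocycle c) (r : R) (γ : Γ) (s : R) :
    c s γ⁻¹ r = (c r γ s)⁻¹ := by
  have := hc r γ s γ⁻¹ r
  rw [inv_mul_cancel, hc.map_one] at this
  exact eq_inv_of_mul_eq_one_left this.symm

end IsOrbitCocycle

namespace EquivariantTree

variable {Γ R : Type u} [Group Γ] (T : EquivariantTree Γ R) {X : Type v} [Group X]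

theorem adj_parent_symm (v : Γ × R) (hv : v ≠ T.root) :
    T.Adj (T.parent v).2 (v.1⁻¹ * (T.parent v).1) v.2 := by
  simpa using T.symm (T.adj_parent v hv)

theorem induction_on {P : Γ × R → Prop} (hroot : P T.root)
    (hparent : ∀ v, v ≠ T.root → P (T.parent v) → P v) (v : Γ × R) : P v := by
  induction hn : T.level v using Nat.strong_induction_on generalizing v with
  | _ n ih =>
    by_cases hv : v = T.root
    · rwa [hv]
    · exact hparent v hv (ih _ (hn ▸ T.level_parent v hv) _ rfl)

/-- Two multiplicative functions on pairs of vertices which agree on edges are equal. -/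
theorem pairing_unique {c c' : Γ × R → Γ × R → X}
    (hc : ∀ v w u, c v u = c w u * c v w) (hc' : ∀ v w u, c' v u = c' w u * c' v w)
    (h : ∀ v w : Γ × R, T.Adj v.2 (w.1⁻¹ * v.1) w.2 → c v w = c' v w) : c = c' := by
  have one (c : Γ × R → Γ × R → X) (hc : ∀ v w u, c v u = c w u * c v w) (v) : c v v = 1 := by
    simpa using hc v v v
  have key (v : Γ × R) : c T.root v = c' T.root v := by
    induction v using T.induction_on with
    | hroot => rw [one c hc, one c' hc']
    | hparent v hv ih =>
      rw [hc _ (T.parent v), hc' _ (T.parent v), ih, h _ _ (T.adj_parent_symm v hv)]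
  funext v w
  have h1 := hc T.root v w
  have h2 := hc' T.root v w
  rw [key, key, h2] at h1
  exact (mul_right_cancel h1).symm

open Classical in
/-- The product of the labels along the path from the root. -/
noncomputable def potential (T : EquivariantTree Γ R) (f : R → Γ → R → X) (v : Γ × R) : X :=
  if _hv : v = T.root then 1
  else f (T.parent v).2 (v.1⁻¹ * (T.parent v).1) v.2 * potential T f (T.parent v)
termination_by T.level v
decreasing_by exact T.level_parent v _hv

theorem potential_of_adj {f : R → Γ → R → X}
    (hf : ∀ r γ s, T.Adj r γ s → f s γ⁻¹ r * f r γ s = 1) (v w : Γ × R)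
    (h : T.Adj v.2 (w.1⁻¹ * v.1) w.2) :
    T.potential f w = f v.2 (w.1⁻¹ * v.1) w.2 * T.potential f v := by
  rcases T.eq_parent v w h with ⟨hv, rfl⟩ | ⟨hw, rfl⟩
  · rw [potential.eq_def T f v, dif_neg hv, ← mul_assoc]
    have := hf _ _ _ (T.symm h)
    rw [inv_inv, mul_inv_rev, inv_inv] at this
    rw [this, one_mul]
  · rw [potential.eq_def T f w, dif_neg hw]

/-- The quotient of potentials at two vertices is multiplicative and restricts to `f` on edges. The
root breaks the symmetry, but a `Γ`-translate of this pairing has the same values on edges, so by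
`pairing_unique` the pairing is `Γ`-invariant and descends to orbits. -/
theorem exists_cocycle {f : R → Γ → R → X}
    (hf : ∀ r γ s, T.Adj r γ s → f s γ⁻¹ r * f r γ s = 1) :
    ∃ c : R → Γ → R → X, IsOrbitCocycle c ∧ ∀ r γ s, T.Adj r γ s → c r γ s = f r γ s := by
  let c (v w : Γ × R) : X := T.potential f w * (T.potential f v)⁻¹
  have hc (v w u) : c v u = c w u * c v w := by simp [c]
  have hcf (v w : Γ × R) (h : T.Adj v.2 (w.1⁻¹ * v.1) w.2) : c v w = f v.2 (w.1⁻¹ * v.1) w.2 := by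
    simp only [c]
    rw [T.potential_of_adj hf v w h, mul_inv_cancel_right]
  have hinv (δ : Γ) : (fun v w : Γ × R ↦ c (δ * v.1, v.2) (δ * w.1, w.2)) = c := by
    refine T.pairing_unique (fun v w u ↦ hc (δ * v.1, v.2) (δ * w.1, w.2) (δ * u.1, u.2)) hc ?_
    intro v w h
    have h' : T.Adj v.2 ((δ * w.1)⁻¹ * (δ * v.1)) w.2 := by simpa [mul_assoc] using h
    rw [hcf v w h, hcf _ _ h']
    simp [mul_assoc]
  refine ⟨fun r γ s ↦ c (γ, r) (1, s), fun r γ s δ t ↦ ?_, fun r γ s h ↦ ?_⟩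
  · have := congr_fun₂ (hinv δ) (γ, r) (1, s)
    simp only [mul_one] at this
    simp only
    rw [← this, ← hc]
  · have := hcf (γ, r) (1, s) (by simpa using h)
    simpa using this

theorem cocycle_unique {c c' : R → Γ → R → X} (hc : IsOrbitCocycle c) (hc' : IsOrbitCocycle c')
    (h : ∀ r γ s, T.Adj r γ s → c r γ s = c' r γ s) : c = c' := by
  have key := T.pairing_unique (c := fun v w ↦ c v.2 (w.1⁻¹ * v.1) w.2)
    (c' := fun v w ↦ c' v.2 (w.1⁻¹ * v.1) w.2)
    (fun v w u ↦ by rw [← hc]; simp [mul_assoc]) (fun v w u ↦ by rw [← hc']; simp [mul_assoc])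
    (fun v w hvw ↦ h _ _ _ hvw)
  funext r γ s
  simpa using congr_fun₂ key (γ, r) (1, s)

/-! ### Orientation of edges and freeness of the group -/

/-- An orientation of the edges, invariant under `Γ`. -/
def Pos (r : R) (γ : Γ) (s : R) : Prop :=
  T.Adj r γ s ∧ WellOrderingRel (r, γ, s) (s, γ⁻¹, r)

theorem not_pos_inv {r : R} {γ : Γ} {s : R} (h : T.Pos r γ s) : ¬ T.Pos s γ⁻¹ r := fun h' ↦ by
  have h2 := h'.2
  rw [inv_inv] at h2
  exact asymm h.2 h2

theorem adj_irrefl (v : Γ × R) : ¬ T.Adj v.2 (v.1⁻¹ * v.1) v.2 := fun h ↦ by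
  have key : v ≠ T.root ∧ v = T.parent v := by rcases T.eq_parent v v h with h | h <;> exact h
  have := T.level_parent v key.1
  rw [← key.2] at this
  exact this.false

/-- The well-order leaves an edge unoriented only if it equals its reversal. Then `γ * γ = 1`, so `γ
= 1` and the edge is a loop, which a tree does not have. -/
theorem pos_or_pos_inv (htf : ∀ γ : Γ, γ * γ = 1 → γ = 1) {r : R} {γ : Γ} {s : R}
    (h : T.Adj r γ s) : T.Pos r γ s ∨ T.Pos s γ⁻¹ r := by
  rcases trichotomous_of WellOrderingRel (r, γ, s) (s, γ⁻¹, r) with h' | h' | h'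
  · exact .inl ⟨h, h'⟩
  · simp only [Prod.mk.injEq] at h'
    obtain ⟨rfl, h', -⟩ := h'
    rw [htf γ (mul_eq_one_iff_eq_inv.mpr h')] at h
    exact (T.adj_irrefl (1, r) (by simpa using h)).elim
  · exact .inr ⟨T.symm h, by simpa using h'⟩

/-- This is the universal property of a free groupoid. Labels on positive edges force the inverse
labels on reversed edges. -/
theorem existsUnique_cocycle (htf : ∀ γ : Γ, γ * γ = 1 → γ = 1)
    (f : {e : R × Γ × R // T.Pos e.1 e.2.1 e.2.2} → X) :
    ∃! c : R → Γ → R → X, IsOrbitCocycle c ∧ ∀ e, c e.1.1 e.1.2.1 e.1.2.2 = f e := by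
  classical
  let g (r : R) (γ : Γ) (s : R) : X :=
    if h : T.Pos r γ s then f ⟨(r, γ, s), h⟩
    -- The value 1 is taken only off the edges, where it plays no role.
    else if h : T.Pos s γ⁻¹ r then (f ⟨(s, γ⁻¹, r), h⟩)⁻¹ else 1
  have hg1 {r γ s} (h : T.Pos r γ s) : g r γ s = f ⟨(r, γ, s), h⟩ := dif_pos h
  have hg2 {r γ s} (h : T.Pos r γ s) : g s γ⁻¹ r = (f ⟨(r, γ, s), h⟩)⁻¹ := by
    simp only [g, inv_inv]
    rw [dif_neg (T.not_pos_inv h), dif_pos h]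
  obtain ⟨c, hc, hcg⟩ := T.exists_cocycle (f := g) fun r γ s h ↦ by
    rcases T.pos_or_pos_inv htf h with h | h
    · rw [hg1 h, hg2 h, inv_mul_cancel]
    · have := hg2 h
      rw [inv_inv] at this
      rw [hg1 h, this, mul_inv_cancel]
  refine ⟨c, ⟨hc, fun e ↦ by rw [hcg _ _ _ e.2.1, hg1 e.2]⟩, fun c' hc' ↦ ?_⟩
  refine T.cocycle_unique hc'.1 hc fun r γ s h ↦ ?_
  rcases T.pos_or_pos_inv htf h with h | h
  · rw [hc'.2 ⟨(r, γ, s), h⟩, hcg _ _ _ h.1, hg1 h]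
  · have h1 := hc'.2 ⟨(s, γ⁻¹, r), h⟩
    have h2 := hcg _ _ _ h.1
    rw [hg1 h, ← h1] at h2
    simp only at h2
    rw [hc.map_inv, hc'.1.map_inv] at h2
    exact (inv_injective h2).symm

open CategoryTheory

/-- The groupoid with objects the vertex orbits and all hom-sets equal to `Γ`. -/
def OrbitGroupoid (_ : EquivariantTree Γ R) : Type u := R

instance : Groupoid.{u} T.OrbitGroupoid where
  Hom _ _ := Γ
  id _ := (1 : Γ)
  -- The order is reversed so that multiplication in `End r`, which is also reversed composition, is
  -- multiplication in `Γ`.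
  comp γ δ := (δ * γ : Γ)
  id_comp _ := mul_one _
  comp_id _ := one_mul _
  assoc _ _ _ := (mul_assoc _ _ _).symm
  inv γ := (γ⁻¹ : Γ)
  inv_comp γ := mul_inv_cancel (G := Γ) γ
  comp_inv γ := inv_mul_cancel (G := Γ) γ

/-- The functor to a group defined by a cocycle. -/
def functorOfCocycle {c : R → Γ → R → X} (hc : IsOrbitCocycle c) :
    T.OrbitGroupoid ⥤ SingleObj X where
  obj _ := SingleObj.star X
  map {r s} γ := c r γ s
  map_id r := hc.map_one r
  map_comp {r s t} γ δ := hc r γ s δ t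

theorem isOrbitCocycle_map (F : T.OrbitGroupoid ⥤ SingleObj X) :
    IsOrbitCocycle (X := X)
      fun r γ s ↦ F.map (show (show T.OrbitGroupoid from r) ⟶ (show T.OrbitGroupoid from s) from γ) :=
  fun r γ s δ t ↦ F.map_comp (X := r) (Y := s) (Z := t) γ δ

/-- The orbit groupoid is freely generated by the positively oriented edges. -/
abbrev isFreeGroupoid (htf : ∀ γ : Γ, γ * γ = 1 → γ = 1) : IsFreeGroupoid T.OrbitGroupoid where
  quiverGenerators := ⟨fun r s ↦ {γ : Γ // T.Pos r γ s}⟩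
  of γ := γ.1
  unique_lift {X} _ f := by
    obtain ⟨c, ⟨hc, hcf⟩, huniq⟩ := T.existsUnique_cocycle htf (X := X)
      fun e ↦ @f e.1.1 e.1.2.2 ⟨e.1.2.1, e.2⟩
    refine ⟨T.functorOfCocycle hc, fun r s γ ↦ hcf ⟨(r, γ.1, s), γ.2⟩, fun F hF ↦ ?_⟩
    have := huniq _ ⟨T.isOrbitCocycle_map F, fun e ↦ hF e.1.1 e.1.2.2 ⟨e.1.2.1, e.2⟩⟩
    refine CategoryTheory.Functor.ext (fun _ ↦ rfl) fun r s γ ↦ ?_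
    simp only [eqToHom_refl, Category.comp_id, Category.id_comp]
    exact congr_fun (congr_fun₂ this r γ) s

/-- All vertex groups of the orbit groupoid are copies of `Γ`, and the identities of `Γ` connect its
objects. -/
theorem isFreeGroup (T : EquivariantTree Γ R) (htf : ∀ γ : Γ, γ * γ = 1 → γ = 1) : IsFreeGroup Γ := by
  let _ := T.isFreeGroupoid htf
  have : Nonempty T.OrbitGroupoid := ⟨T.root.2⟩
  have : IsConnected T.OrbitGroupoid :=
    zigzag_isConnected fun r s ↦ .of_hom (show r ⟶ s from (1 : Γ))
  let r₀ : T.OrbitGroupoid := T.root.2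
  have := IsFreeGroupoid.endIsFreeOfConnectedFree (G := T.OrbitGroupoid) r₀
  let e : End r₀ ≃* Γ :=
    { toFun := id, invFun := id, left_inv := fun _ ↦ rfl, right_inv := fun _ ↦ rfl,
      map_mul' := fun _ _ ↦ rfl }
  exact IsFreeGroup.ofMulEquiv e

end EquivariantTree

/-! ### The rank, by counting cocycles -/

open Classical in
/-- A cocycle on the orbit groupoid amounts to a homomorphism from the vertex group together with
the values at the identities out of a base point. -/
noncomputable def orbitCocycleEquiv {Γ R M : Type*} [Group Γ] [CommGroup M] (r₀ : R) :
    {c : R → Γ → R → M // IsOrbitCocycle c} ≃ (Γ →* M) × ({r : R // r ≠ r₀} → M) where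
  toFun c := ⟨MonoidHom.mk' (fun γ ↦ c.1 r₀ γ r₀) fun γ δ ↦ c.2 r₀ δ r₀ γ r₀, fun r ↦ c.1 r₀ 1 r⟩
  -- The cocycle is `φ` twisted by a function on `R`, normalized to be 1 at `r₀` since a cocycle is
  -- 1 on identities.
  invFun p := ⟨fun r γ s ↦ (if hs : s = r₀ then 1 else p.2 ⟨s, hs⟩) * p.1 γ *
      (if hr : r = r₀ then 1 else p.2 ⟨r, hr⟩)⁻¹, fun r γ s δ t ↦ by
    simp only [map_mul]
    simp only [mul_assoc, inv_mul_cancel_left]⟩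
  left_inv c := by
    ext r γ s
    have h (r : R) : (if hr : r = r₀ then 1 else c.1 r₀ 1 r) = c.1 r₀ 1 r := by
      split_ifs with hr
      · rw [hr, c.2.map_one]
      · rfl
    simp only [MonoidHom.mk'_apply, h]
    rw [← c.2.map_inv, ← c.2, inv_one, ← c.2, one_mul, mul_one]
  right_inv p := by
    refine Prod.ext (MonoidHom.ext fun γ ↦ ?_) (funext fun r ↦ ?_)
    · simp
    · simp [r.2]

namespace EquivariantTree

variable {Γ R : Type u} [Group Γ] (T : EquivariantTree Γ R)

/-- Cocycles correspond to arbitrary labellings of the positively oriented edges. -/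
noncomputable def cocycleEquiv (htf : ∀ γ : Γ, γ * γ = 1 → γ = 1) (X : Type v) [Group X] :
    {c : R → Γ → R → X // IsOrbitCocycle c} ≃
      ({e : R × Γ × R // T.Pos e.1 e.2.1 e.2.2} → X) :=
  Equiv.ofBijective (fun c e ↦ c.1 e.1.1 e.1.2.1 e.1.2.2) <| by
    refine ⟨fun c c' h ↦ Subtype.ext ?_, fun f ↦ ?_⟩
    · exact (T.existsUnique_cocycle htf fun e ↦ c'.1 e.1.1 e.1.2.1 e.1.2.2).unique
        ⟨c.2, congr_fun h⟩ ⟨c'.2, fun _ ↦ rfl⟩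
    · obtain ⟨c, ⟨hc, hcf⟩, -⟩ := T.existsUnique_cocycle htf f
      exact ⟨⟨c, hc⟩, funext hcf⟩

/-- The oriented edges are the positive ones and their inverses. -/
noncomputable def posSumPosEquiv (htf : ∀ γ : Γ, γ * γ = 1 → γ = 1) :
    {e : R × Γ × R // T.Pos e.1 e.2.1 e.2.2} ⊕ {e : R × Γ × R // T.Pos e.1 e.2.1 e.2.2} ≃
      {e : R × Γ × R // T.Adj e.1 e.2.1 e.2.2} :=
  Equiv.ofBijective
    (Sum.elim (fun e ↦ ⟨e.1, e.2.1⟩) fun e ↦ ⟨(e.1.2.2, e.1.2.1⁻¹, e.1.1), T.symm e.2.1⟩) <| by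
    constructor
    · rintro (⟨⟨r, γ, s⟩, h⟩ | ⟨⟨r, γ, s⟩, h⟩) (⟨⟨r', γ', s'⟩, h'⟩ | ⟨⟨r', γ', s'⟩, h'⟩) he <;>
        simp only [Sum.elim_inl, Sum.elim_inr, Subtype.mk.injEq, Prod.mk.injEq, inv_inj] at he <;>
        obtain ⟨rfl, rfl, rfl⟩ := he
      · rfl
      · exact (T.not_pos_inv h' h).elim
      · exact (T.not_pos_inv h h').elim
      · rfl
    · rintro ⟨⟨r, γ, s⟩, h⟩
      rcases T.pos_or_pos_inv htf h with h | h
      · exact ⟨.inl ⟨_, h⟩, rfl⟩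
      · exact ⟨.inr ⟨(s, γ⁻¹, r), h⟩, by simp⟩

/-- The oriented edges modulo `Γ`, sorted by their end point. -/
def adjEquivSigma : {e : R × Γ × R // T.Adj e.1 e.2.1 e.2.2} ≃
    Σ s : R, {v : Γ × R // T.Adj v.2 v.1 s} where
  toFun e := ⟨e.1.2.2, (e.1.2.1, e.1.1), e.2⟩
  invFun p := ⟨(p.2.1.2, p.2.1.1, p.1), p.2.2⟩
  left_inv _ := rfl
  right_inv _ := rfl

theorem finite_pos [Finite R] {d : ℕ} (hd0 : d ≠ 0)
    (hd : ∀ s, Nat.card {v : Γ × R // T.Adj v.2 v.1 s} = d) :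
    Finite {e : R × Γ × R // T.Pos e.1 e.2.1 e.2.2} := by
  have (s : R) : Finite {v : Γ × R // T.Adj v.2 v.1 s} :=
    Nat.finite_of_card_ne_zero (by rw [hd]; exact hd0)
  have : Finite {e : R × Γ × R // T.Adj e.1 e.2.1 e.2.2} := .of_equiv _ T.adjEquivSigma.symm
  exact Finite.of_injective (fun e ↦ (⟨e.1, e.2.1⟩ : {e : R × Γ × R // T.Adj e.1 e.2.1 e.2.2}))
    fun a b h ↦ Subtype.ext (Subtype.mk.inj h)

theorem two_mul_card_pos [Finite R] (htf : ∀ γ : Γ, γ * γ = 1 → γ = 1) {d : ℕ} (hd0 : d ≠ 0)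
    (hd : ∀ s, Nat.card {v : Γ × R // T.Adj v.2 v.1 s} = d) :
    2 * Nat.card {e : R × Γ × R // T.Pos e.1 e.2.1 e.2.2} = Nat.card R * d := by
  have := T.finite_pos hd0 hd
  have hfin (s : R) : Finite {v : Γ × R // T.Adj v.2 v.1 s} :=
    Nat.finite_of_card_ne_zero (by rw [hd]; exact hd0)
  have := Fintype.ofFinite R
  rw [two_mul, ← Nat.card_sum, Nat.card_congr ((T.posSumPosEquiv htf).trans T.adjEquivSigma),
    Nat.card_sigma]
  simp [hd]

/-- Both sides of the identity are exponents of 2 in the number of cocycles with values in a group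
of order 2: edge labels on one side, a homomorphism from `Γ` plus `|R| - 1` free values on the
other. The basis `ι` is arbitrary, so finiteness of the rank comes out as well. -/
theorem card_pos_eq [Finite R] (htf : ∀ γ : Γ, γ * γ = 1 → γ = 1) {d : ℕ} (hd0 : d ≠ 0)
    (hd : ∀ s, Nat.card {v : Γ × R // T.Adj v.2 v.1 s} = d) {ι : Type*}
    (e : Γ ≃* FreeGroup ι) :
    Finite ι ∧ Nat.card {e : R × Γ × R // T.Pos e.1 e.2.1 e.2.2} + 1 = Nat.card ι + Nat.card R := by
  have := T.finite_pos hd0 hd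
  let M := Multiplicative (ZMod 2)
  have hM : Nat.card M = 2 := by simp [M]
  let r₀ := T.root.2
  let E : ({e : R × Γ × R // T.Pos e.1 e.2.1 e.2.2} → M) ≃ (ι → M) × ({r : R // r ≠ r₀} → M) :=
    (T.cocycleEquiv htf M).symm.trans <| (orbitCocycleEquiv r₀).trans <|
      ((MulEquiv.monoidHomCongrLeftEquiv e).trans FreeGroup.lift.symm).prodCongr (.refl _)
  have : Finite ((ι → M) × ({r : R // r ≠ r₀} → M)) := .of_equiv _ E
  have : Finite (ι → M) := Finite.prod_left ({r : R // r ≠ r₀} → M)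
  have : Finite ι := by
    rw [← not_infinite_iff_finite]
    intro h
    exact not_finite (ι → M)
  refine ⟨this, ?_⟩
  have h := Nat.card_congr E
  rw [Nat.card_prod, Nat.card_fun, Nat.card_fun, Nat.card_fun, hM, ← pow_add] at h
  have h2 := Nat.pow_right_injective le_rfl h
  classical
  have := Fintype.ofFinite R
  have h3 : Nat.card {r : R // r ≠ r₀} + 1 = Nat.card R := by
    rw [Nat.card_eq_fintype_card, Nat.card_eq_fintype_card, Fintype.card_subtype_compl (· = r₀),
      Fintype.card_subtype_eq]
    exact Nat.sub_add_cancel (Fintype.card_pos_iff.mpr ⟨r₀⟩)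
  rw [h2, add_assoc, h3]

/-- A torsion-free group acting with finitely many orbits on a regular tree is free of finite
rank. -/
theorem exists_mulEquiv_freeGroup [Finite R] (T : EquivariantTree Γ R)
    (htf : ∀ γ : Γ, γ * γ = 1 → γ = 1) {d : ℕ} (hd0 : d ≠ 0)
    (hd : ∀ s, Nat.card {v : Γ × R // T.Adj v.2 v.1 s} = d) :
    ∃ n : ℕ, Nonempty (Γ ≃* FreeGroup (Fin n)) := by
  have := T.isFreeGroup htf
  have e := IsFreeGroup.toFreeGroup Γ
  have := (T.card_pos_eq htf hd0 hd e).1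
  exact ⟨_, ⟨e.trans (FreeGroup.freeGroupCongr (Finite.equivFin _))⟩⟩

/-- The rank of a group acting on a regular tree. -/
theorem two_mul_rank_add_card [Finite R] (T : EquivariantTree Γ R)
    (htf : ∀ γ : Γ, γ * γ = 1 → γ = 1) {d : ℕ} (hd0 : d ≠ 0)
    (hd : ∀ s, Nat.card {v : Γ × R // T.Adj v.2 v.1 s} = d) {n : ℕ}
    (e : Γ ≃* FreeGroup (Fin n)) :
    2 * (n + Nat.card R) = Nat.card R * d + 2 := by
  have h1 := (T.card_pos_eq htf hd0 hd e).2
  have h2 := T.two_mul_card_pos htf hd0 hd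
  rw [Nat.card_fin] at h1
  lia

end EquivariantTree

/-! ### Matrices in `PGL(2, F)` and the Cartan decomposition -/

section PGL2

variable {F : Type*} [Field F]

/-- The class in `PGL(2, F)` of the matrix with rows `(a, b)` and `(c, d)`. -/
noncomputable def pglOf (a b c d : F) (h : a * d - b * c ≠ 0) : PGL(2, F) :=
  .mk (.mkOfDetNeZero !![a, b; c, d] (by rwa [Matrix.det_fin_two_of]))

theorem exists_eq_pglOf (g : PGL(2, F)) : ∃ a b c d h, g = pglOf (F := F) a b c d h := by
  obtain ⟨g, rfl⟩ := Matrix.ProjGenLinGroup.mk_surjective g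
  have h := g.det.ne_zero
  rw [Matrix.GeneralLinearGroup.val_det_apply, Matrix.det_fin_two] at h
  refine ⟨g 0 0, g 0 1, g 1 0, g 1 1, h, congrArg _ (Units.ext ?_)⟩
  exact Matrix.eta_fin_two _

theorem pglOf_eq_iff {a b c d a' b' c' d' : F} {h : a * d - b * c ≠ 0}
    {h' : a' * d' - b' * c' ≠ 0} :
    pglOf a b c d h = pglOf a' b' c' d' h' ↔
      ∃ z : F, z ≠ 0 ∧ a' = z * a ∧ b' = z * b ∧ c' = z * c ∧ d' = z * d := by
  rw [pglOf, pglOf, Matrix.ProjGenLinGroup.mk_eq_mk_iff]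
  have key (u : Fˣ) : Matrix.GeneralLinearGroup.mkOfDetNeZero !![a, b; c, d]
        (by rwa [Matrix.det_fin_two_of]) * Matrix.GeneralLinearGroup.scalar (Fin 2) u =
      Matrix.GeneralLinearGroup.mkOfDetNeZero !![a', b'; c', d']
        (by rwa [Matrix.det_fin_two_of]) ↔
      a' = u * a ∧ b' = u * b ∧ c' = u * c ∧ d' = u * d := by
    rw [Units.ext_iff, ← Matrix.ext_iff]
    simp [Matrix.GeneralLinearGroup.mkOfDetNeZero, Fin.forall_fin_two, Matrix.mul_apply,
      Fin.sum_univ_two, mul_comm, eq_comm, and_assoc]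
  simp only [key]
  exact ⟨fun ⟨u, hu⟩ ↦ ⟨u, u.ne_zero, hu⟩, fun ⟨z, hz, hu⟩ ↦ ⟨Units.mk0 z hz, hu⟩⟩

theorem det_mul_ne_zero {a b c d a' b' c' d' : F} (h : a * d - b * c ≠ 0)
    (h' : a' * d' - b' * c' ≠ 0) :
    (a * a' + b * c') * (c * b' + d * d') - (a * b' + b * d') * (c * a' + d * c') ≠ 0 := by
  convert mul_ne_zero h h' using 1
  ring

theorem pglOf_mul (a b c d a' b' c' d' : F) (h : a * d - b * c ≠ 0)
    (h' : a' * d' - b' * c' ≠ 0) :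
    pglOf a b c d h * pglOf a' b' c' d' h' =
      pglOf (a * a' + b * c') (a * b' + b * d') (c * a' + d * c') (c * b' + d * d')
        (det_mul_ne_zero h h') := by
  rw [pglOf, pglOf, pglOf, ← map_mul]
  congr 1
  refine Units.ext ?_
  simp [Matrix.GeneralLinearGroup.mkOfDetNeZero]

/-- The class of the permutation matrix. -/
noncomputable def pglSwap (F : Type*) [Field F] : PGL(2, F) :=
  pglOf 0 1 1 0 (by simp)

/-- The class of a lower unipotent matrix. -/
noncomputable def pglLower (x : F) : PGL(2, F) := pglOf 1 0 x 1 (by simp)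

theorem pglSwap_mul_self : pglSwap F * pglSwap F = 1 := by
  have h1 : (1 : PGL(2, F)) = pglOf 1 0 0 1 (by simp) := by
    rw [pglOf, eq_comm, ← Matrix.ProjGenLinGroup.mk_one]
    congr 1
    refine Units.ext ?_
    exact Matrix.one_fin_two.symm
  rw [h1, pglSwap, pglOf_mul, pglOf_eq_iff]
  exact ⟨1, by simp⟩

variable [ValuativeRel F]

local notation "ν" => ValuativeRel.valuation F

theorem mem_pgl2Integers_iff {g : PGL(2, F)} :
    g ∈ pgl2Integers F ↔ ∃ a b c d h, (ν a ≤ 1 ∧ ν b ≤ 1 ∧ ν c ≤ 1 ∧ ν d ≤ 1) ∧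
      ν (a * d - b * c) = 1 ∧ g = pglOf (F := F) a b c d h := by
  have hint := Valuation.integer.integers (ValuativeRel.valuation F)
  constructor
  · rintro ⟨k, rfl⟩
    obtain ⟨k, rfl⟩ := Matrix.ProjGenLinGroup.mk_surjective k
    have hdet := k.det.isUnit
    rw [hint.isUnit_iff_valuation_eq_one, Matrix.GeneralLinearGroup.val_det_apply,
      Matrix.det_fin_two] at hdet
    have hdet' : ν ((k 0 0 : F) * (k 1 1 : F) - (k 0 1 : F) * (k 1 0 : F)) = 1 := hdet
    refine ⟨k 0 0, k 0 1, k 1 0, k 1 1, ?_, ⟨(k 0 0).2, (k 0 1).2, (k 1 0).2, (k 1 1).2⟩,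
      hdet', ?_⟩
    · intro h
      simp [h] at hdet'
    · rw [Matrix.ProjGenLinGroup.map_mk, pglOf]
      congr 1
      refine Units.ext ?_
      exact Matrix.eta_fin_two _
  · rintro ⟨a, b, c, d, h, ⟨ha, hb, hc, hd⟩, hdet, rfl⟩
    let A : Matrix (Fin 2) (Fin 2) 𝒪[F] := !![⟨a, ha⟩, ⟨b, hb⟩; ⟨c, hc⟩, ⟨d, hd⟩]
    have hA : IsUnit A.det := by
      rw [hint.isUnit_iff_valuation_eq_one, Matrix.det_fin_two_of]
      exact hdet
    refine ⟨.mk (Matrix.GeneralLinearGroup.mk'' A hA), ?_⟩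
    rw [Matrix.ProjGenLinGroup.map_mk, pglOf]
    congr 1
    refine Units.ext ?_
    exact Matrix.eta_fin_two _

theorem pglOf_mem {a b c d : F} {h : a * d - b * c ≠ 0} (ha : ν a ≤ 1) (hb : ν b ≤ 1)
    (hc : ν c ≤ 1) (hd : ν d ≤ 1) (hdet : ν (a * d - b * c) = 1) :
    pglOf a b c d h ∈ pgl2Integers F :=
  mem_pgl2Integers_iff.mpr ⟨a, b, c, d, h, ⟨ha, hb, hc, hd⟩, hdet, rfl⟩

/-- An integral representative with unit determinant differs from the given one by a scalar, and
comparing determinants shows that this scalar has valuation 1. -/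
theorem entries_le_one {a b c d : F} {h : a * d - b * c ≠ 0}
    (hmem : pglOf a b c d h ∈ pgl2Integers F) (hdet : ν (a * d - b * c) = 1) :
    ν a ≤ 1 ∧ ν b ≤ 1 ∧ ν c ≤ 1 ∧ ν d ≤ 1 := by
  obtain ⟨a', b', c', d', h', hle, hdet', heq⟩ := mem_pgl2Integers_iff.mp hmem
  obtain ⟨z, hz, rfl, rfl, rfl, rfl⟩ := pglOf_eq_iff.mp heq
  have hz1 : ν z = 1 := by
    have : ν (z ^ 2 * (a * d - b * c)) = 1 := by
      rw [← hdet']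
      congr 1
      ring
    rw [map_mul, hdet, mul_one, map_pow] at this
    exact (pow_eq_one_iff_of_nonneg zero_le two_ne_zero).mp this
  simpa [hz1] using hle

theorem valuation_det_lt_one {a b c d : F} (ha : ν a < 1) (hc : ν c < 1) (hb : ν b ≤ 1)
    (hd : ν d ≤ 1) : ν (a * d - b * c) < 1 := by
  refine (Valuation.map_sub _ _ _).trans_lt (max_lt ?_ ?_)
  · rw [map_mul]
    exact (mul_le_of_le_one_right' hd).trans_lt ha
  · rw [map_mul]
    exact (mul_le_of_le_one_left' hb).trans_lt hc

/-- A uniformizer, in terms of the valuation. -/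
structure IsValuationUniformizer (p : F) : Prop where
  ne_zero : p ≠ 0
  lt_one : ν p < 1
  exists_pow : ∀ x : F, x ≠ 0 → ν x ≤ 1 → ∃ n : ℕ, ν x = ν p ^ n

theorem IsValuationUniformizer.div_le_one {p : F} (hp : IsValuationUniformizer p) {x : F}
    (hx : ν x < 1) : ν (x / p) ≤ 1 := by
  by_cases hx0 : x = 0
  · simp [hx0]
  obtain ⟨n, hn⟩ := hp.exists_pow x hx0 hx.le
  have hp0 : ν p ≠ 0 := by simpa using hp.ne_zero
  have hn0 : n ≠ 0 := by
    rintro rfl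
    simp [hn] at hx
  rw [map_div₀, hn, div_le_one₀ (zero_lt_iff.mpr hp0)]
  exact pow_le_of_le_one zero_le hp.lt_one.le hn0

section Diagonal

variable {p : F}

theorem one_mul_pow_ne_zero (hp : IsValuationUniformizer p) (n : ℕ) :
    (1 : F) * p ^ n - 0 * 0 ≠ 0 := by
  simp [hp.ne_zero]

/-- The class of the diagonal matrix with entries `1` and `p ^ n`. -/
noncomputable def pglDiag (hp : IsValuationUniformizer p) (n : ℕ) : PGL(2, F) :=
  pglOf 1 0 0 (p ^ n) (one_mul_pow_ne_zero hp n)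

theorem pglSwap_mem : pglSwap F ∈ pgl2Integers F := by
  apply pglOf_mem <;> simp

theorem pglLower_mem {x : F} (hx : ν x ≤ 1) : pglLower x ∈ pgl2Integers F := by
  apply pglOf_mem <;> simp [hx]

/-- The Cartan decomposition when the upper left entry dominates. -/
theorem cartan_of_le (hp : IsValuationUniformizer p) {a b c d : F} (h : a * d - b * c ≠ 0)
    (hb : ν b ≤ ν a) (hc : ν c ≤ ν a) (hd : ν d ≤ ν a) :
    ∃ k ∈ pgl2Integers F, ∃ n, ∃ k' ∈ pgl2Integers F,
      pglOf a b c d h = k * pglDiag hp n * k' := by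
  have ha : a ≠ 0 := by
    rintro rfl
    simp only [map_zero, le_zero_iff, map_eq_zero] at hb
    simp [hb] at h
  have ha' : 0 < ν a := zero_lt_iff.mpr (by simpa using ha)
  have hb1 : ν (b / a) ≤ 1 := by rwa [map_div₀, div_le_one₀ ha']
  have hc1 : ν (c / a) ≤ 1 := by rwa [map_div₀, div_le_one₀ ha']
  have hd1 : ν (d / a) ≤ 1 := by rwa [map_div₀, div_le_one₀ ha']
  let e := d / a - b / a * (c / a)
  have he0 : e ≠ 0 := by
    intro he
    apply h
    have : a * d - b * c = a ^ 2 * e := by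
      simp only [e]
      field_simp
    rw [this, he, mul_zero]
  have he1 : ν e ≤ 1 := (Valuation.map_sub _ _ _).trans
    (max_le hd1 (by rw [map_mul]; exact mul_le_one' hb1 hc1))
  obtain ⟨n, hn⟩ := hp.exists_pow e he0 he1
  have hpn : p ^ n ≠ 0 := pow_ne_zero _ hp.ne_zero
  have hu : ν (e / p ^ n) = 1 := by
    rw [map_div₀, map_pow, hn, div_self]
    simpa using hpn
  -- Clearing the first row and column with the pivot `a` leaves `diag(1, e)` up to the scalar `a`;
  -- the unit `e / p ^ n` is moved into the left factor.
  refine ⟨pglOf 1 0 (c / a) (e / p ^ n) (by simp [he0, hpn]), ?_, n,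
    pglOf 1 (b / a) 0 1 (by simp), ?_, ?_⟩
  · refine pglOf_mem ?_ ?_ hc1 hu.le ?_ <;> simp [hu]
  · refine pglOf_mem ?_ hb1 ?_ ?_ ?_ <;> simp
  · rw [pglDiag, pglOf_mul, pglOf_mul, pglOf_eq_iff]
    refine ⟨a⁻¹, inv_ne_zero ha, ?_, ?_, ?_, ?_⟩
    · simp [ha]
    · field_simp
      ring
    · field_simp
      ring
    · simp only [e]
      field_simp
      ring

/-- Swapping rows and columns, which stays inside the double coset, brings an entry of largest
valuation to the upper left corner. -/
theorem cartan_decomposition (hp : IsValuationUniformizer p) (g : PGL(2, F)) :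
    ∃ k ∈ pgl2Integers F, ∃ n, ∃ k' ∈ pgl2Integers F, g = k * pglDiag hp n * k' := by
  have left (g : PGL(2, F)) (h : ∃ k ∈ pgl2Integers F, ∃ n, ∃ k' ∈ pgl2Integers F,
      pglSwap F * g = k * pglDiag hp n * k') :
      ∃ k ∈ pgl2Integers F, ∃ n, ∃ k' ∈ pgl2Integers F, g = k * pglDiag hp n * k' := by
    obtain ⟨k, hk, n, k', hk', h⟩ := h
    refine ⟨_, mul_mem pglSwap_mem hk, n, k', hk', ?_⟩
    rw [mul_assoc, mul_assoc, ← mul_assoc k, ← h, ← mul_assoc, pglSwap_mul_self, one_mul]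
  have right (g : PGL(2, F)) (h : ∃ k ∈ pgl2Integers F, ∃ n, ∃ k' ∈ pgl2Integers F,
      g * pglSwap F = k * pglDiag hp n * k') :
      ∃ k ∈ pgl2Integers F, ∃ n, ∃ k' ∈ pgl2Integers F, g = k * pglDiag hp n * k' := by
    obtain ⟨k, hk, n, k', hk', h⟩ := h
    refine ⟨k, hk, n, _, mul_mem hk' pglSwap_mem, ?_⟩
    rw [← mul_assoc, ← h, mul_assoc, pglSwap_mul_self, mul_one]
  have top {a b c d : F} (h : a * d - b * c ≠ 0) (hcol : max (ν c) (ν d) ≤ max (ν a) (ν b)) :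
      ∃ k ∈ pgl2Integers F, ∃ n, ∃ k' ∈ pgl2Integers F,
        pglOf a b c d h = k * pglDiag hp n * k' := by
    rcases le_total (ν b) (ν a) with hab | hab
    · rw [max_eq_left hab, max_le_iff] at hcol
      exact cartan_of_le hp h hab hcol.1 hcol.2
    · rw [max_eq_right hab, max_le_iff] at hcol
      apply right
      rw [pglSwap, pglOf_mul]
      apply cartan_of_le hp <;> simp [hab, hcol.1, hcol.2]
  obtain ⟨a, b, c, d, h, rfl⟩ := exists_eq_pglOf g
  rcases le_total (max (ν c) (ν d)) (max (ν a) (ν b)) with hle | hle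
  · exact top h hle
  · apply left
    rw [pglSwap, pglOf_mul]
    apply top
    simpa using hle

/-- The two matrices agree up to a scalar `z`. If `ν z < 1`, the first column of `k` is divisible by
the uniformizer; if `ν z > 1`, the first row of `k'` is. Both contradict unit determinants, so `ν z
= 1` and determinants give `n = m`. -/
theorem pglDiag_unique (hp : IsValuationUniformizer p) {k k' : PGL(2, F)}
    (hk : k ∈ pgl2Integers F) (hk' : k' ∈ pgl2Integers F) {n m : ℕ}
    (h : k * pglDiag hp n = pglDiag hp m * k') : n = m := by
  obtain ⟨a, b, c, d, h0, ⟨ha, hb, hc, hd⟩, hdet, rfl⟩ := mem_pgl2Integers_iff.mp hk'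
  obtain ⟨a', b', c', d', h0', ⟨ha', hb', hc', hd'⟩, hdet', rfl⟩ := mem_pgl2Integers_iff.mp hk
  rw [pglDiag, pglDiag, pglOf_mul, pglOf_mul, eq_comm, pglOf_eq_iff] at h
  obtain ⟨z, hz, e1, e2, e3, e4⟩ := h
  simp only [mul_one, mul_zero, add_zero, one_mul, zero_mul, zero_add] at e1 e2 e3 e4
  have hpow (n : ℕ) : ν (p ^ n) ≤ 1 := by
    rw [map_pow]
    exact pow_le_one₀ zero_le hp.lt_one.le
  have hz1 : 1 ≤ ν z := by
    by_contra! hlt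
    refine (valuation_det_lt_one (a := a') (c := c') ?_ ?_ hb' hd').ne hdet'
    · rw [e1, map_mul]
      exact (mul_le_of_le_one_right' ha).trans_lt hlt
    · rw [e3, map_mul, map_mul]
      exact (mul_le_of_le_one_right' (mul_le_one' (hpow m) hc)).trans_lt hlt
  have hz2 : ν z ≤ 1 := by
    by_contra! hlt
    have hlt' : ν z⁻¹ < 1 := by
      rw [map_inv₀]
      exact inv_lt_one_of_one_lt₀ hlt
    have hdet2 : ν (a * d - c * b) = 1 := by rw [mul_comm c, hdet]
    refine (valuation_det_lt_one (a := a) (c := b) ?_ ?_ hc hd).ne hdet2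
    · rw [show a = z⁻¹ * a' by rw [e1]; field_simp, map_mul]
      exact (mul_le_of_le_one_right' ha').trans_lt hlt'
    · rw [show b = z⁻¹ * (b' * p ^ n) by rw [e2]; field_simp, map_mul, map_mul]
      exact (mul_le_of_le_one_right' (mul_le_one' hb' (hpow n))).trans_lt hlt'
  have hdets : (a' * d' - b' * c') * p ^ n = z ^ 2 * (a * d - b * c) * p ^ m := by
    linear_combination a' * e4 + z * p ^ m * d * e1 - c' * e2 - z * b * e3
  have hv := congrArg (ValuativeRel.valuation F) hdets
  rw [map_mul, map_mul, map_mul, hdet, hdet', map_pow, map_pow, map_pow, le_antisymm hz2 hz1,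
    one_pow, one_mul, one_mul, one_mul] at hv
  exact pow_right_injective₀ (zero_lt_iff.mpr (by simpa using hp.ne_zero)) hp.lt_one.ne hv

end Diagonal

end PGL2

/-! ### The tree on the cosets of `PGL(2, 𝒪_F)` -/

section Tree

variable {F : Type*} [Field F] [ValuativeRel F] {p : F} (hp : IsValuationUniformizer p)

local notation "ν" => ValuativeRel.valuation F

/-- Adjacency of vertices of the tree of `PGL(2, F)`, the vertices being the cosets of
`PGL(2, 𝒪_F)`. -/
def TreeAdj (v w : PGL(2, F) ⧸ pgl2Integers F) : Prop :=
  ∃ g : PGL(2, F), v = g ∧ w = (g * pglDiag hp 1 : PGL(2, F))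

theorem mk_mul_mem {k : PGL(2, F)} (hk : k ∈ pgl2Integers F) (g : PGL(2, F)) :
    ((g * k : PGL(2, F)) : PGL(2, F) ⧸ pgl2Integers F) = g :=
  QuotientGroup.mk_mul_of_mem g hk

/-- The class of the diagonal matrix with entries `p` and `1`. -/
noncomputable def pglDiagSwap : PGL(2, F) := pglOf p 0 0 1 (by simpa using hp.ne_zero)

theorem swap_mul_diag_mul_swap :
    pglSwap F * pglDiag hp 1 * pglSwap F = pglDiagSwap hp := by
  rw [pglSwap, pglDiag, pglOf_mul, pglOf_mul, pglDiagSwap, pglOf_eq_iff]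
  exact ⟨1, by simp⟩

theorem diag_succ_mul_diagSwap (n : ℕ) :
    pglDiag hp (n + 1) * pglDiagSwap hp = pglDiag hp n := by
  rw [pglDiag, pglDiagSwap, pglOf_mul, pglDiag, pglOf_eq_iff]
  refine ⟨p⁻¹, inv_ne_zero hp.ne_zero, ?_⟩
  have := hp.ne_zero
  simp only [one_mul, zero_mul, mul_zero, add_zero, zero_add, mul_one, pow_succ]
  refine ⟨?_, trivial, trivial, ?_⟩ <;> field_simp

theorem diag_zero_eq : pglDiag hp 0 = 1 := by
  rw [← pglSwap_mul_self (F := F), pglDiag, pglSwap, pglOf_mul, pglOf_eq_iff]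
  exact ⟨1, by simp⟩

theorem diag_mul_diag_one (n : ℕ) : pglDiag hp n * pglDiag hp 1 = pglDiag hp (n + 1) := by
  rw [pglDiag, pglDiag, pglOf_mul, pglDiag, pglOf_eq_iff]
  exact ⟨1, by simp [pow_succ]⟩

theorem diag_mul_lower (n : ℕ) (x : F) :
    pglDiag hp n * pglLower x = pglLower (p ^ n * x) * pglDiag hp n := by
  rw [pglDiag, pglLower, pglLower, pglOf_mul, pglOf_mul, pglOf_eq_iff]
  exact ⟨1, by simp⟩

theorem TreeAdj.symm {v w : PGL(2, F) ⧸ pgl2Integers F} (h : TreeAdj hp v w) :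
    TreeAdj hp w v := by
  obtain ⟨g, rfl, rfl⟩ := h
  refine ⟨g * pglDiag hp 1 * pglSwap F, (mk_mul_mem pglSwap_mem _).symm, ?_⟩
  have h : pglDiag hp 1 * pglSwap F * pglDiag hp 1 = pglSwap F := by
    have h1 := diag_succ_mul_diagSwap hp 0
    rw [← swap_mul_diag_mul_swap, diag_zero_eq, zero_add, ← mul_assoc] at h1
    rw [← mul_left_inj (pglSwap F), pglSwap_mul_self, ← h1]
    simp only [mul_assoc]
  rw [mul_assoc, mul_assoc, ← mul_assoc (pglDiag hp 1), h, mk_mul_mem pglSwap_mem]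

theorem TreeAdj.smul {v w : PGL(2, F) ⧸ pgl2Integers F} (h : TreeAdj hp v w) (g : PGL(2, F)) :
    TreeAdj hp (g • v) (g • w) := by
  obtain ⟨g', rfl, rfl⟩ := h
  exact ⟨g * g', rfl, by rw [mul_assoc]; rfl⟩

/-- The neighbours of the base vertex, as the points of the projective line over the residue
field. -/
theorem neighbour_cases {k : PGL(2, F)} (hk : k ∈ pgl2Integers F) :
    ((k * pglDiag hp 1 : PGL(2, F)) : PGL(2, F) ⧸ pgl2Integers F) = pglDiagSwap hp ∨
    ∃ y, ν y ≤ 1 ∧ ∀ x, ν x ≤ 1 → ν (y - x) < 1 →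
      ((k * pglDiag hp 1 : PGL(2, F)) : PGL(2, F) ⧸ pgl2Integers F) =
        (pglLower x * pglDiag hp 1 : PGL(2, F)) := by
  obtain ⟨a, b, c, d, h0, ⟨ha, hb, hc, hd⟩, hdet, rfl⟩ := mem_pgl2Integers_iff.mp hk
  have hp0 := hp.ne_zero
  -- The first column of `k` modulo `p` is a point of the projective line: infinity if `a` reduces
  -- to 0, otherwise the class of `c / a`.
  rcases ha.lt_or_eq with ha1 | ha1
  · left
    have h' : a / p * (p * d) - b * c ≠ 0 := by
      convert h0 using 2
      field_simp
    have hmem : pglOf (a / p) b c (p * d) h' ∈ pgl2Integers F := by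
      refine pglOf_mem (hp.div_le_one ha1) hb hc ?_ ?_
      · rw [map_mul]
        exact mul_le_one' hp.lt_one.le hd
      · rw [← hdet]
        congr 2
        field_simp
    rw [← mk_mul_mem hmem (pglDiagSwap hp)]
    congr 1
    rw [pglDiag, pglDiagSwap, pglOf_mul, pglOf_mul, pglOf_eq_iff]
    refine ⟨1, one_ne_zero, ?_⟩
    simp only [one_mul, zero_mul, mul_zero, add_zero, zero_add, mul_one, pow_one]
    refine ⟨by field_simp, mul_comm _ _, trivial, mul_comm _ _⟩
  · right
    have ha0 : a ≠ 0 := by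
      rintro rfl
      simp at ha1
    refine ⟨c / a, by rwa [map_div₀, ha1, div_one], fun x hx hxy ↦ ?_⟩
    have h' : a * (d - b * x) - p * b * ((c - a * x) / p) ≠ 0 := by
      convert h0 using 1
      field_simp
      ring
    have hmem : pglOf a (p * b) ((c - a * x) / p) (d - b * x) h' ∈ pgl2Integers F := by
      refine pglOf_mem ha ?_ (hp.div_le_one ?_) ?_ ?_
      · rw [map_mul]
        exact mul_le_one' hp.lt_one.le hb
      · rw [show c - a * x = a * (c / a - x) by field_simp, map_mul, ha1, one_mul]
        exact hxy
      · refine (Valuation.map_sub _ _ _).trans (max_le hd ?_)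
        rw [map_mul]
        exact mul_le_one' hb hx
      · rw [← hdet]
        congr 1
        field_simp
        ring
    rw [← mk_mul_mem hmem (pglLower x * pglDiag hp 1)]
    congr 1
    rw [pglDiag, pglLower, pglOf_mul, pglOf_mul, pglOf_mul, pglOf_eq_iff]
    refine ⟨1, one_ne_zero, ?_⟩
    simp only [one_mul, zero_mul, mul_zero, add_zero, zero_add, mul_one, pow_one]
    refine ⟨trivial, mul_comm _ _, ?_, ?_⟩
    · field_simp
      ring
    · ring

theorem lower_injective {x y : F}
    (h : ((pglLower x * pglDiag hp 1 : PGL(2, F)) : PGL(2, F) ⧸ pgl2Integers F) =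
      (pglLower y * pglDiag hp 1 : PGL(2, F))) : ν (x - y) < 1 := by
  have hp0 := hp.ne_zero
  rw [eq_comm, QuotientGroup.eq] at h
  have h' : (1 : F) * 1 - 0 * ((x - y) / p) ≠ 0 := by simp
  have key : (pglLower y * pglDiag hp 1)⁻¹ * (pglLower x * pglDiag hp 1) =
      pglOf 1 0 ((x - y) / p) 1 h' := by
    rw [inv_mul_eq_iff_eq_mul, pglDiag, pglLower, pglLower, pglOf_mul, pglOf_mul, pglOf_mul,
      pglOf_eq_iff]
    refine ⟨1, one_ne_zero, ?_⟩
    simp only [one_mul, zero_mul, mul_zero, add_zero, zero_add, mul_one, pow_one, true_and, and_true]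
    field_simp
    ring
  rw [key] at h
  have h2 := (entries_le_one h (by simp)).2.2.1
  rw [map_div₀, div_le_one₀ (zero_lt_iff.mpr (by simpa using hp0))] at h2
  exact h2.trans_lt hp.lt_one

theorem lower_ne_diagSwap (x : F) :
    ((pglLower x * pglDiag hp 1 : PGL(2, F)) : PGL(2, F) ⧸ pgl2Integers F) ≠ pglDiagSwap hp := by
  intro h
  have hp0 := hp.ne_zero
  rw [eq_comm, QuotientGroup.eq] at h
  have h' : p⁻¹ * p - 0 * x ≠ 0 := by simp [hp0]
  have key : (pglDiagSwap hp)⁻¹ * (pglLower x * pglDiag hp 1) = pglOf p⁻¹ 0 x p h' := by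
    rw [inv_mul_eq_iff_eq_mul, pglDiag, pglLower, pglDiagSwap, pglOf_mul, pglOf_mul, pglOf_eq_iff]
    refine ⟨1, one_ne_zero, ?_⟩
    simp [hp0]
  rw [key] at h
  have h2 := (entries_le_one h (by simp [hp0])).1
  rw [map_inv₀, inv_le_one₀ (zero_lt_iff.mpr (by simpa using hp0))] at h2
  exact h2.not_gt hp.lt_one

theorem exists_eq_mk_mul_diag (v : PGL(2, F) ⧸ pgl2Integers F) :
    ∃ n, ∃ k ∈ pgl2Integers F, v = (k * pglDiag hp n : PGL(2, F)) := by
  obtain ⟨g, rfl⟩ := QuotientGroup.mk_surjective v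
  obtain ⟨k, hk, n, k', hk', rfl⟩ := cartan_decomposition hp g
  exact ⟨n, k, hk, mk_mul_mem hk' _⟩

/-- The distance from the base vertex. -/
noncomputable def treeLevel (v : PGL(2, F) ⧸ pgl2Integers F) : ℕ :=
  (exists_eq_mk_mul_diag hp v).choose

/-- The neighbour which is closer to the base vertex. -/
noncomputable def treeParent (v : PGL(2, F) ⧸ pgl2Integers F) : PGL(2, F) ⧸ pgl2Integers F :=
  ((exists_eq_mk_mul_diag hp v).choose_spec.choose * pglDiag hp (treeLevel hp v - 1) : PGL(2, F))

/-- Level and parent come from one chosen decomposition. That the parent does not depend on this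
choice is never needed separately. -/
theorem exists_treeParent_eq (v : PGL(2, F) ⧸ pgl2Integers F) :
    ∃ k ∈ pgl2Integers F, v = (k * pglDiag hp (treeLevel hp v) : PGL(2, F)) ∧
      treeParent hp v = (k * pglDiag hp (treeLevel hp v - 1) : PGL(2, F)) :=
  ⟨_, (exists_eq_mk_mul_diag hp v).choose_spec.choose_spec.1,
    (exists_eq_mk_mul_diag hp v).choose_spec.choose_spec.2, rfl⟩

theorem treeLevel_mk {k : PGL(2, F)} (hk : k ∈ pgl2Integers F) (n : ℕ) :
    treeLevel hp (k * pglDiag hp n : PGL(2, F)) = n := by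
  obtain ⟨k', hk', h, -⟩ := exists_treeParent_eq hp (k * pglDiag hp n : PGL(2, F))
  generalize treeLevel hp _ = m at h
  rw [QuotientGroup.eq] at h
  refine (pglDiag_unique hp (k := k'⁻¹ * k) (mul_mem (inv_mem hk') hk) (inv_mem h) ?_).symm
  group

theorem treeLevel_treeParent (v : PGL(2, F) ⧸ pgl2Integers F) :
    treeLevel hp (treeParent hp v) = treeLevel hp v - 1 := by
  obtain ⟨k, hk, -, h⟩ := exists_treeParent_eq hp v
  rw [h, treeLevel_mk hp hk]

theorem treeLevel_ne_zero {v : PGL(2, F) ⧸ pgl2Integers F} (hv : v ≠ (1 : PGL(2, F))) :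
    treeLevel hp v ≠ 0 := by
  obtain ⟨k, hk, h, -⟩ := exists_treeParent_eq hp v
  intro h0
  rw [h0, diag_zero_eq, mul_one, ← one_mul k, mk_mul_mem hk] at h
  exact hv h

theorem treeAdj_treeParent {v : PGL(2, F) ⧸ pgl2Integers F} (hv : v ≠ (1 : PGL(2, F))) :
    TreeAdj hp v (treeParent hp v) := by
  obtain ⟨k, hk, h1, h2⟩ := exists_treeParent_eq hp v
  refine TreeAdj.symm hp ⟨_, h2, ?_⟩
  rw [mul_assoc, diag_mul_diag_one, Nat.sub_add_cancel (Nat.pos_of_ne_zero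
    (treeLevel_ne_zero hp hv)), ← h1]

/-- After translation by `k * pglDiag hp n`, the neighbour at infinity is the parent if `n > 0`,
because `diag(1, p ^ n) * diag(p, 1)` is `diag(1, p ^ (n - 1))` up to a scalar. The others move
outwards, since a lower unipotent matrix passes to the left of the diagonal one and stays integral.
-/
theorem eq_treeParent_or_level_eq {v w : PGL(2, F) ⧸ pgl2Integers F} (h : TreeAdj hp v w) :
    (v ≠ (1 : PGL(2, F)) ∧ w = treeParent hp v) ∨ treeLevel hp w = treeLevel hp v + 1 := by
  obtain ⟨k, hk, h1, h2⟩ := exists_treeParent_eq hp v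
  obtain ⟨g, hg, rfl⟩ := h
  obtain ⟨k', hk', hkg⟩ : ∃ k' ∈ pgl2Integers F, g = k * pglDiag hp (treeLevel hp v) * k' := by
    rw [h1, QuotientGroup.eq] at hg
    exact ⟨_, hg, by group⟩
  generalize hn : treeLevel hp v = n at *
  have hw : ((g * pglDiag hp 1 : PGL(2, F)) : PGL(2, F) ⧸ pgl2Integers F) =
      (k * pglDiag hp n) • ((k' * pglDiag hp 1 : PGL(2, F)) : PGL(2, F) ⧸ pgl2Integers F) := by
    rw [hkg, mul_assoc]
    rfl
  rcases neighbour_cases hp hk' with h | ⟨y, hy, h⟩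
  · rw [h, MulAction.Quotient.smul_coe, smul_eq_mul] at hw
    rcases n with _ | n
    · right
      rw [hw, diag_zero_eq, mul_one, ← swap_mul_diag_mul_swap, ← mul_assoc, mk_mul_mem pglSwap_mem,
        ← mul_assoc, treeLevel_mk hp (mul_mem hk pglSwap_mem)]
    · left
      refine ⟨?_, ?_⟩
      · rintro rfl
        have := treeLevel_mk hp (one_mem _) 0
        rw [diag_zero_eq, mul_one, hn] at this
        lia
      · rw [hw, mul_assoc, diag_succ_mul_diagSwap, h2]
        rfl
  · right
    rw [h y hy (by simp), MulAction.Quotient.smul_coe, smul_eq_mul, mul_assoc k, ← mul_assoc _ _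
      (pglDiag hp 1), diag_mul_lower, mul_assoc _ _ (pglDiag hp 1), diag_mul_diag_one,
      ← mul_assoc] at hw
    rw [hw, treeLevel_mk]
    refine mul_mem hk (pglLower_mem ?_)
    rw [map_mul, map_pow]
    exact mul_le_one' (pow_le_one₀ zero_le hp.lt_one.le) hy

theorem eq_treeParent_of_treeAdj {v w : PGL(2, F) ⧸ pgl2Integers F} (h : TreeAdj hp v w) :
    (v ≠ (1 : PGL(2, F)) ∧ w = treeParent hp v) ∨ (w ≠ (1 : PGL(2, F)) ∧ v = treeParent hp w) := by
  rcases eq_treeParent_or_level_eq hp h with h1 | h1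
  · exact .inl h1
  · rcases eq_treeParent_or_level_eq hp (h.symm hp) with h2 | h2
    · exact .inr h2
    · lia

/-- The number of neighbours of a vertex. -/
theorem card_treeAdj [IsLocalRing 𝒪[F]] [Finite 𝓀[F]] (v : PGL(2, F) ⧸ pgl2Integers F) :
    Nat.card {w // TreeAdj hp w v} = Nat.card 𝓀[F] + 1 := by
  have hint := Valuation.integer.integers (ValuativeRel.valuation F)
  have hres (x : 𝒪[F]) : IsLocalRing.residue 𝒪[F] x = 0 ↔ ν (x : F) < 1 := by
    rw [IsLocalRing.residue_eq_zero_iff, IsLocalRing.mem_maximalIdeal, mem_nonunits_iff,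
      hint.isUnit_iff_valuation_eq_one]
    exact (lt_iff_le_and_ne.trans (and_iff_right x.2)).symm
  -- Neighbours are labelled by the projective line over the residue field: `none` is infinity, and
  -- `σ` lifts the finite points.
  obtain ⟨σ, hσ⟩ := (IsLocalRing.residue_surjective (R := 𝒪[F])).hasRightInverse
  obtain ⟨g, rfl⟩ := QuotientGroup.mk_surjective v
  let f : Option 𝓀[F] → PGL(2, F) ⧸ pgl2Integers F := fun x ↦
    g • (x.elim ((pglDiagSwap hp : PGL(2, F)) : PGL(2, F) ⧸ pgl2Integers F)
      fun x ↦ (pglLower (σ x : F) * pglDiag hp 1 : PGL(2, F)))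
  have hfadj (x) : TreeAdj hp (f x) g := by
    apply TreeAdj.symm
    rcases x with _ | x
    · refine ⟨g * pglSwap F, (mk_mul_mem pglSwap_mem _).symm, ?_⟩
      rw [← mk_mul_mem pglSwap_mem (g * pglSwap F * pglDiag hp 1), mul_assoc, mul_assoc,
        ← mul_assoc (pglSwap F), swap_mul_diag_mul_swap]
      rfl
    · refine ⟨g * pglLower (σ x : F), (mk_mul_mem (pglLower_mem (σ x).2) _).symm, ?_⟩
      rw [mul_assoc]
      rfl
  have hbij : Function.Bijective
      (fun x ↦ ⟨f x, hfadj x⟩ : Option 𝓀[F] → {w // TreeAdj hp w g}) := by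
    constructor
    · intro x y hxy
      have hxy := smul_left_cancel _ (Subtype.mk.inj hxy)
      rcases x with _ | x <;> rcases y with _ | y
      · rfl
      · exact (lower_ne_diagSwap hp _ hxy.symm).elim
      · exact (lower_ne_diagSwap hp _ hxy).elim
      · have := lower_injective hp hxy
        rw [← AddSubgroupClass.coe_sub, ← hres, map_sub, hσ, hσ, sub_eq_zero] at this
        rw [this]
    · rintro ⟨w, hw⟩
      obtain ⟨g', hg, rfl⟩ := hw.symm hp
      rw [QuotientGroup.eq] at hg
      have hw' : ((g' * pglDiag hp 1 : PGL(2, F)) : PGL(2, F) ⧸ pgl2Integers F) =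
          g • ((g⁻¹ * g' * pglDiag hp 1 : PGL(2, F)) : PGL(2, F) ⧸ pgl2Integers F) := by
        rw [MulAction.Quotient.smul_coe, smul_eq_mul]
        group
      rcases neighbour_cases hp hg with h | ⟨y, hy, h⟩
      · exact ⟨none, Subtype.ext (hw'.trans (congrArg (g • ·) h)).symm⟩
      · refine ⟨some (IsLocalRing.residue _ ⟨y, hy⟩), Subtype.ext
          (hw'.trans (congrArg (g • ·) (h _ (σ (IsLocalRing.residue _ ⟨y, hy⟩)).2 ?_))).symm⟩
        have := hres (⟨y, hy⟩ - σ (IsLocalRing.residue _ ⟨y, hy⟩))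
        rw [map_sub, hσ, sub_self] at this
        exact this.mp rfl
  rw [← Nat.card_congr (Equiv.ofBijective _ hbij), Finite.card_option]

theorem exists_isValuationUniformizer [IsDiscreteValuationRing 𝒪[F]] :
    ∃ p : F, IsValuationUniformizer p := by
  have hint := Valuation.integer.integers (ValuativeRel.valuation F)
  obtain ⟨ϖ, hϖ⟩ := IsDiscreteValuationRing.exists_irreducible 𝒪[F]
  refine ⟨ϖ, by simpa using hϖ.ne_zero, lt_of_le_of_ne ϖ.2 fun h ↦
    hϖ.not_isUnit (hint.isUnit_iff_valuation_eq_one.mpr h), fun x hx0 hx ↦ ?_⟩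
  obtain ⟨n, u, hu⟩ := IsDiscreteValuationRing.eq_unit_mul_pow_irreducible
    (x := (⟨x, hx⟩ : 𝒪[F])) (fun h ↦ hx0 (congrArg Subtype.val h)) hϖ
  refine ⟨n, ?_⟩
  have hu1 : ν ((u : 𝒪[F]) : F) = 1 := hint.isUnit_iff_valuation_eq_one.mp u.isUnit
  have := congrArg (fun y : 𝒪[F] ↦ ν (y : F)) hu
  simpa [hu1] using this

end Tree

/-! ### Topology of `PGL(2, F)`: stabilizers and orbits -/

section Topology

instance pgl2IsTopologicalGroup (R : Type*) [CommRing R] [TopologicalSpace R]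
    [IsTopologicalRing R] : IsTopologicalGroup PGL(2, R) :=
  inferInstanceAs (IsTopologicalGroup (GL (Fin 2) R ⧸ Subgroup.center (GL (Fin 2) R)))

theorem isClosed_center_of_t2 (G : Type*) [Group G] [TopologicalSpace G] [IsTopologicalGroup G]
    [T2Space G] : IsClosed (Subgroup.center G : Set G) := by
  have : (Subgroup.center G : Set G) = ⋂ g : G, {z | g * z = z * g} := by
    ext z
    simp [Subgroup.mem_center_iff]
  rw [this]
  exact isClosed_iInter fun g ↦ isClosed_eq (by fun_prop) (by fun_prop)

instance pgl2T2Space (R : Type*) [CommRing R] [TopologicalSpace R] [IsTopologicalRing R]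
    [T2Space R] : T2Space PGL(2, R) := by
  have := isClosed_center_of_t2 (GL (Fin 2) R)
  exact inferInstanceAs (T2Space (GL (Fin 2) R ⧸ Subgroup.center (GL (Fin 2) R)))

theorem continuous_projGenLinGroup_mk (R : Type*) [CommRing R] [TopologicalSpace R] :
    Continuous (Matrix.ProjGenLinGroup.mk : GL (Fin 2) R → PGL(2, R)) :=
  continuous_quotient_mk'

theorem isOpen_pgl2_iff {R : Type*} [CommRing R] [TopologicalSpace R] {s : Set PGL(2, R)} :
    IsOpen s ↔ IsOpen ((Matrix.ProjGenLinGroup.mk : GL (Fin 2) R → PGL(2, R)) ⁻¹' s) :=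
  Iff.rfl

variable (F : Type*) [Field F] [ValuativeRel F] [TopologicalSpace F]
    [IsNonarchimedeanLocalField F]

theorem IsNonarchimedeanLocalField.t2Space : T2Space F := by
  let := IsTopologicalAddGroup.rightUniformSpace F
  have := isUniformAddGroup_of_addCommGroup (G := F)
  infer_instance

theorem isCompact_pgl2Integers : IsCompact (pgl2Integers F : Set PGL(2, F)) := by
  have := IsNonarchimedeanLocalField.t2Space F
  have : CompactSpace (Matrix (Fin 2) (Fin 2) 𝒪[F]) := Pi.compactSpace
  have : CompactSpace (GL (Fin 2) 𝒪[F]) :=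
    inferInstanceAs (CompactSpace (Matrix (Fin 2) (Fin 2) 𝒪[F])ˣ)
  have hcont : Continuous (fun g : GL (Fin 2) 𝒪[F] ↦ Matrix.ProjGenLinGroup.mk
      (Matrix.GeneralLinearGroup.map (algebraMap 𝒪[F] F) g)) := by
    refine (continuous_projGenLinGroup_mk F).comp ?_
    refine Continuous.units_map (M := Matrix (Fin 2) (Fin 2) 𝒪[F]) _ ?_
    exact continuous_id.matrix_map continuous_subtype_val
  convert isCompact_range hcont
  ext x
  constructor
  · rintro ⟨k, rfl⟩
    obtain ⟨k, rfl⟩ := Matrix.ProjGenLinGroup.mk_surjective k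
    exact ⟨k, rfl⟩
  · rintro ⟨k, rfl⟩
    exact ⟨.mk k, rfl⟩

/-- A subgroup is open once it contains a neighbourhood of 1. In `GL(2, F)`, integrality of the
entries and of the inverse determinant is an open condition that forces a unit determinant. -/
theorem isOpen_pgl2Integers : IsOpen (pgl2Integers F : Set PGL(2, F)) := by
  rw [isOpen_pgl2_iff]
  refine Subgroup.isOpen_of_mem_nhds ((pgl2Integers F).comap Matrix.ProjGenLinGroup.mk) (g := 1) ?_
  have hO : IsOpen (𝒪[F] : Set F) := Valuation.isOpen_integer
  have hentry (i j : Fin 2) : IsOpen {g : GL (Fin 2) F | g i j ∈ 𝒪[F]} :=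
    hO.preimage (Units.continuous_val.matrix_elem i j)
  have hdet : IsOpen {g : GL (Fin 2) F | (g⁻¹ : GL (Fin 2) F).val.det ∈ 𝒪[F]} :=
    hO.preimage ((Units.continuous_val.comp continuous_inv).matrix_det)
  have hall := (((hentry 0 0).inter (hentry 0 1)).inter
    ((hentry 1 0).inter (hentry 1 1))).inter hdet
  refine Filter.mem_of_superset (hall.mem_nhds ?_) ?_
  · simp
  · rintro g ⟨⟨⟨h1, h2⟩, ⟨h3, h4⟩⟩, h5⟩
    have h0 : g.val.det ≠ 0 := by
      rw [← Matrix.GeneralLinearGroup.val_det_apply]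
      exact g.det.ne_zero
    have hmul : g.val.det * (g⁻¹ : GL (Fin 2) F).val.det = 1 := by
      rw [← Matrix.det_mul, ← Units.val_mul, mul_inv_cancel, Units.val_one, Matrix.det_one]
    rw [Matrix.det_fin_two g.val] at h0 hmul
    refine mem_pgl2Integers_iff.mpr ⟨g 0 0, g 0 1, g 1 0, g 1 1, h0, ⟨h1, h2, h3, h4⟩, ?_,
      congrArg _ (Units.ext (Matrix.eta_fin_two _))⟩
    apply le_antisymm
    · exact 𝒪[F].sub_mem (𝒪[F].mul_mem h1 h4) (𝒪[F].mul_mem h2 h3)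
    · have := congrArg (ValuativeRel.valuation F) hmul
      rw [map_mul, map_one] at this
      rw [← this]
      exact mul_le_of_le_one_right' h5

/-- A discrete torsion-free group meets the conjugates of a compact subgroup trivially. -/
theorem eq_one_of_smul_eq {G : Type*} [Group G] [TopologicalSpace G] [IsTopologicalGroup G]
    [T2Space G] {K Γ : Subgroup G} (hK : IsCompact (K : Set G))
    (htf : ∀ γ ∈ Γ, IsOfFinOrder γ → γ = 1) (hdisc : DiscreteTopology Γ) (γ : Γ) (v : G ⧸ K)
    (h : γ • v = v) : γ = 1 := by
  obtain ⟨g, rfl⟩ := QuotientGroup.mk_surjective v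
  have hmem : g⁻¹ * γ * g ∈ K := by
    have h' : ((γ * g : G) : G ⧸ K) = g := h
    rw [eq_comm, QuotientGroup.eq] at h'
    rwa [mul_assoc]
  have hcomp : IsCompact {x : G | g⁻¹ * x * g ∈ K} := by
    convert hK.image (f := fun k ↦ g * k * g⁻¹) (by fun_prop)
    ext x
    constructor
    · exact fun hx ↦ ⟨_, hx, by group⟩
    · rintro ⟨k, hk, rfl⟩
      have : g⁻¹ * (g * k * g⁻¹) * g = k := by group
      rw [Set.mem_ofPred_eq, this]
      exact hk
  -- A discrete subgroup is closed, so the stabilizer is compact and discrete, hence finite; it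
  -- contains all powers of `γ`.
  have hcomp' : IsCompact {x : Γ | g⁻¹ * x * g ∈ K} :=
    (Subgroup.isClosed_of_discrete (H := Γ)).isClosedEmbedding_subtypeVal.isCompact_preimage hcomp
  have hfin := hcomp'.finite_of_discrete
  refine Subtype.ext (htf γ γ.2 ?_)
  rw [Submonoid.isOfFinOrder_coe]
  by_contra hinf
  refine (Set.infinite_range_of_injective (injective_pow_iff_not_isOfFinOrder.mpr hinf))
    (hfin.subset ?_)
  rintro _ ⟨n, rfl⟩
  have : g⁻¹ * ((γ ^ n : Γ) : G) * g = (g⁻¹ * γ * g) ^ n := by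
    have := conj_pow (a := g⁻¹) (b := (γ : G)) (i := n)
    simpa using this.symm
  rw [Set.mem_ofPred_eq, this]
  exact pow_mem hmem n

/-- A cocompact group has finitely many double cosets with respect to an open subgroup. -/
theorem finite_orbits_of_compact {G : Type*} [Group G] [TopologicalSpace G] [IsTopologicalGroup G]
    {K Γ : Subgroup G} (hK : IsOpen (K : Set G))
    (hcpt : CompactSpace (Quotient (QuotientGroup.rightRel Γ))) :
    Finite (Quotient (MulAction.orbitRel Γ (G ⧸ K))) := by
  let f : Quotient (QuotientGroup.rightRel Γ) → Quotient (MulAction.orbitRel Γ (G ⧸ K)) :=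
    Quotient.map' (fun g ↦ (g : G ⧸ K)) fun a b hab ↦ by
      rw [QuotientGroup.rightRel_apply] at hab
      rw [MulAction.orbitRel_apply]
      refine ⟨⟨_, inv_mem hab⟩, ?_⟩
      change (((b * a⁻¹)⁻¹ * b : G) : G ⧸ K) = a
      congr 1
      group
  -- Cosets of the open subgroup `K` are open, and a locally constant map on a compact space has
  -- finite range.
  have hf : IsLocallyConstant f := by
    intro s
    have := QuotientGroup.discreteTopology hK
    have hopen : IsOpen ((fun g : G ↦ (g : G ⧸ K)) ⁻¹' (Quotient.mk _ ⁻¹' s)) :=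
      (isOpen_discrete _).preimage QuotientGroup.continuous_mk
    exact hopen
  have hsurj : Function.Surjective f := by
    intro r
    obtain ⟨v, rfl⟩ := Quotient.exists_rep r
    obtain ⟨g, rfl⟩ := QuotientGroup.mk_surjective v
    exact ⟨Quotient.mk _ g, rfl⟩
  have := hf.range_finite
  rw [hsurj.range_eq] at this
  exact Set.finite_univ_iff.mp this

end Topology

/-! ### From a free action on a tree to an equivariant tree -/

section FreeAction

variable {Γ V : Type u} [Group Γ] [MulAction Γ V]

/-- A set with a free action is a product of the group and the set of orbits. -/
noncomputable def freeActionEquiv (hfree : ∀ (γ : Γ) (v : V), γ • v = v → γ = 1) :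
    Γ × Quotient (MulAction.orbitRel Γ V) ≃ V :=
  Equiv.ofBijective (fun p ↦ p.1 • p.2.out) <| by
    constructor
    · rintro ⟨γ, r⟩ ⟨δ, s⟩ h
      simp only at h
      have hrs : r = s := by
        rw [← r.out_eq, ← s.out_eq]
        refine Quotient.sound (MulAction.orbitRel_apply.mpr ⟨γ⁻¹ * δ, ?_⟩)
        simp only
        rw [mul_smul, ← h, inv_smul_smul]
      subst hrs
      have := hfree (δ⁻¹ * γ) r.out (by rw [mul_smul, h, inv_smul_smul])
      rw [Prod.mk.injEq]
      exact ⟨(inv_mul_eq_one.mp this).symm, rfl⟩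
    · intro v
      obtain ⟨γ, hγ⟩ := MulAction.orbitRel_apply.mp (Quotient.exact (Quotient.out_eq
        (Quotient.mk (MulAction.orbitRel Γ V) v)).symm)
      exact ⟨(γ, _), hγ⟩

theorem freeActionEquiv_mul (hfree : ∀ (γ : Γ) (v : V), γ • v = v → γ = 1) (δ γ : Γ)
    (r : Quotient (MulAction.orbitRel Γ V)) :
    freeActionEquiv hfree (δ * γ, r) = δ • freeActionEquiv hfree (γ, r) :=
  mul_smul _ _ _

theorem freeActionEquiv_adj_iff (hfree : ∀ (γ : Γ) (v : V), γ • v = v → γ = 1)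
    {Adj : V → V → Prop} (hsmul : ∀ (γ : Γ) v w, Adj v w → Adj (γ • v) (γ • w))
    (v w : Γ × Quotient (MulAction.orbitRel Γ V)) :
    Adj (freeActionEquiv hfree (w.1⁻¹ * v.1, v.2)) (freeActionEquiv hfree (1, w.2)) ↔
      Adj (freeActionEquiv hfree v) (freeActionEquiv hfree w) := by
  constructor <;> intro h
  · have := hsmul w.1 _ _ h
    rw [← freeActionEquiv_mul, ← freeActionEquiv_mul] at this
    simpa using this
  · have := hsmul w.1⁻¹ _ _ h
    rw [← freeActionEquiv_mul hfree _ v.1 v.2, ← freeActionEquiv_mul hfree _ w.1 w.2] at this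
    simpa using this

/-- A free action on a tree gives an equivariant tree. -/
noncomputable def EquivariantTree.ofFreeAction
    (hfree : ∀ (γ : Γ) (v : V), γ • v = v → γ = 1) {Adj : V → V → Prop}
    (hsmul : ∀ (γ : Γ) v w, Adj v w → Adj (γ • v) (γ • w))
    (hsymm : ∀ v w, Adj v w → Adj w v) (o : V) (level : V → ℕ) (parent : V → V)
    (hlevel : ∀ v, v ≠ o → level (parent v) < level v)
    (hparent : ∀ v, v ≠ o → Adj v (parent v))
    (heq : ∀ v w, Adj v w → (v ≠ o ∧ w = parent v) ∨ (w ≠ o ∧ v = parent w)) :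
    EquivariantTree Γ (Quotient (MulAction.orbitRel Γ V)) where
  Adj r γ s := Adj (freeActionEquiv hfree (γ, r)) (freeActionEquiv hfree (1, s))
  symm {r γ s} h := by
    have := hsmul γ⁻¹ _ _ (hsymm _ _ h)
    rwa [← freeActionEquiv_mul, ← freeActionEquiv_mul, inv_mul_cancel, mul_one] at this
  root := (freeActionEquiv hfree).symm o
  level v := level (freeActionEquiv hfree v)
  parent v := (freeActionEquiv hfree).symm (parent (freeActionEquiv hfree v))
  level_parent v hv := by
    rw [Equiv.apply_symm_apply]
    exact hlevel _ fun h ↦ hv ((Equiv.eq_symm_apply _).mpr h)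
  adj_parent v hv := by
    rw [freeActionEquiv_adj_iff hfree hsmul v, Equiv.apply_symm_apply]
    exact hparent _ fun h ↦ hv ((Equiv.eq_symm_apply _).mpr h)
  eq_parent v w h := by
    rw [freeActionEquiv_adj_iff hfree hsmul v w] at h
    simpa only [ne_eq, Equiv.eq_symm_apply] using heq _ _ h

end FreeAction

/-! ### A fundamental domain made of cosets -/

section FundamentalDomain

open MeasureTheory

variable {G : Type u} [Group G] [TopologicalSpace G] [IsTopologicalGroup G] {K Γ : Subgroup G}

/-- The union of the cosets of `K` representing the orbits. -/
def orbitDomain (K Γ : Subgroup G) : Set G :=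
  ⋃ r : Quotient (MulAction.orbitRel Γ (G ⧸ K)), {g : G | (g : G ⧸ K) = r.out}

theorem isOpen_setOf_mk_eq (hK : IsOpen (K : Set G)) (v : G ⧸ K) :
    IsOpen {g : G | (g : G ⧸ K) = v} := by
  have := QuotientGroup.discreteTopology hK
  exact (isOpen_discrete {v}).preimage QuotientGroup.continuous_mk

variable [MeasurableSpace G] [BorelSpace G] (μ : Measure G)

theorem measure_setOf_mk_eq [μ.IsMulLeftInvariant] (v : G ⧸ K) : μ {g : G | (g : G ⧸ K) = v} = μ K := by
  obtain ⟨g, rfl⟩ := QuotientGroup.mk_surjective v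
  rw [← measure_preimage_mul μ g⁻¹ (K : Set G)]
  congr 1
  ext x
  exact eq_comm.trans QuotientGroup.eq

theorem isFundamentalDomain_orbitDomain (hK : IsOpen (K : Set G))
    (hfree : ∀ (γ : Γ) (v : G ⧸ K), γ • v = v → γ = 1) :
    IsFundamentalDomain Γ (orbitDomain K Γ) μ := by
  refine .mk' (isOpen_iUnion fun r ↦ isOpen_setOf_mk_eq hK _).measurableSet.nullMeasurableSet
    fun g ↦ ?_
  have key (γ : Γ) : γ • g ∈ orbitDomain K Γ ↔
      ∃ r, freeActionEquiv hfree (γ⁻¹, r) = (g : G ⧸ K) := by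
    rw [orbitDomain, Set.mem_iUnion]
    refine exists_congr fun r ↦ ?_
    change γ • (g : G ⧸ K) = r.out ↔ γ⁻¹ • r.out = (g : G ⧸ K)
    rw [inv_smul_eq_iff, eq_comm]
  simp only [key]
  -- The unique coordinates of the coset of `g` in `Γ × R` single out the one translate of `g` in
  -- the domain.
  obtain ⟨⟨γ, r⟩, h⟩ := (freeActionEquiv hfree).surjective (g : G ⧸ K)
  refine ⟨γ⁻¹, ⟨r, by rwa [inv_inv]⟩, ?_⟩
  rintro δ ⟨s, hs⟩
  have := (freeActionEquiv hfree).injective (h.trans hs.symm)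
  rw [(Prod.mk.inj this).1, inv_inv]

theorem measure_orbitDomain [μ.IsMulLeftInvariant] (hK : IsOpen (K : Set G))
    [Finite (Quotient (MulAction.orbitRel Γ (G ⧸ K)))] :
    μ (orbitDomain K Γ) = Nat.card (Quotient (MulAction.orbitRel Γ (G ⧸ K))) * μ K := by
  have := Fintype.ofFinite (Quotient (MulAction.orbitRel Γ (G ⧸ K)))
  rw [orbitDomain, measure_iUnion ?_ fun r ↦ (isOpen_setOf_mk_eq hK _).measurableSet]
  · simp only [measure_setOf_mk_eq, tsum_fintype, Finset.sum_const, Finset.card_univ, nsmul_eq_mul,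
      Nat.card_eq_fintype_card]
  · intro r s hrs
    rw [Function.onFun, Set.disjoint_left]
    intro g hr hs
    exact hrs (Quotient.out_injective (hr.symm.trans hs))

end FundamentalDomain

/-! ### The volume formula -/

theorem mainTheorem3 (F : Type*) [Field F] [ValuativeRel F] [TopologicalSpace F]
    [IsNonarchimedeanLocalField F]
    [MeasurableSpace PGL(2, F)] [BorelSpace PGL(2, F)]
    (μ : MeasureTheory.Measure PGL(2, F)) [μ.IsHaarMeasure]
    (hμ : μ (pgl2Integers F : Set PGL(2, F)) = ((Nat.card 𝓀[F] : ℝ≥0∞) - 1) / 2)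
    (Γ : Subgroup PGL(2, F))
    (htf : ∀ γ ∈ Γ, IsOfFinOrder γ → γ = 1)
    (hdisc : DiscreteTopology Γ)
    (hcpt : CompactSpace (Quotient (QuotientGroup.rightRel Γ))) :
    MeasureTheory.HasFundamentalDomain Γ PGL(2, F) μ ∧
    (∃ n : ℕ, Nonempty (Γ ≃* FreeGroup (Fin n))) ∧
    ∀ n : ℕ, Nonempty (Γ ≃* FreeGroup (Fin n)) →
      MeasureTheory.covolume Γ PGL(2, F) μ ≠ ∞ ∧
      (MeasureTheory.covolume Γ PGL(2, F) μ).toReal = (n : ℝ) - 1 := by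
  have := IsNonarchimedeanLocalField.t2Space F
  have hopen := isOpen_pgl2Integers F
  have hfree := eq_one_of_smul_eq (isCompact_pgl2Integers F) htf hdisc
  have hfinite := finite_orbits_of_compact hopen hcpt
  have hdom := isFundamentalDomain_orbitDomain μ hopen hfree
  obtain ⟨p, hp⟩ := exists_isValuationUniformizer (F := F)
  let T := EquivariantTree.ofFreeAction (Adj := TreeAdj hp) hfree
    (fun γ v w h ↦ h.smul hp γ) (fun v w h ↦ h.symm hp) ((1 : PGL(2, F)) : PGL(2, F) ⧸ _)
    (treeLevel hp) (treeParent hp)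
    (fun v hv ↦ by
      rw [treeLevel_treeParent]
      exact Nat.sub_one_lt (treeLevel_ne_zero hp hv))
    (fun v hv ↦ treeAdj_treeParent hp hv) (fun v w h ↦ eq_treeParent_of_treeAdj hp h)
  have htf' (γ : Γ) (h : γ * γ = 1) : γ = 1 := by
    refine Subtype.ext (htf γ γ.2 (isOfFinOrder_iff_pow_eq_one.mpr ⟨2, two_pos, ?_⟩))
    rw [pow_two]
    exact congrArg Subtype.val h
  have hdeg (s) : Nat.card {v : Γ × _ // T.Adj v.2 v.1 s} = Nat.card 𝓀[F] + 1 := by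
    rw [← card_treeAdj hp (freeActionEquiv hfree (1, s))]
    exact Nat.card_congr ((freeActionEquiv hfree).subtypeEquiv fun _ ↦ Iff.rfl)
  refine ⟨⟨_, hdom⟩, T.exists_mulEquiv_freeGroup htf' (Nat.succ_ne_zero _) hdeg, ?_⟩
  rintro n ⟨e⟩
  have hrank := T.two_mul_rank_add_card htf' (Nat.succ_ne_zero _) hdeg e
  -- Countability makes the covolume independent of the fundamental domain.
  have : Countable Γ := e.toEquiv.countable_iff.mpr inferInstance
  have hcov : MeasureTheory.covolume Γ PGL(2, F) μ =
      Nat.card (Quotient (MulAction.orbitRel Γ (PGL(2, F) ⧸ pgl2Integers F))) *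
        (((Nat.card 𝓀[F] : ℝ≥0∞) - 1) / 2) := by
    rw [hdom.covolume_eq_volume, measure_orbitDomain μ hopen, hμ]
  -- This keeps the subtraction `q - 1` in `ℝ≥0∞` from being truncated.
  have hq : (1 : ℝ≥0∞) ≤ Nat.card 𝓀[F] := by
    exact_mod_cast Nat.card_pos
  rw [hcov]
  refine ⟨?_, ?_⟩
  · exact ENNReal.mul_ne_top (by simp) (ENNReal.div_ne_top (by simp) two_ne_zero)
  · rw [ENNReal.toReal_mul, ENNReal.toReal_div, ENNReal.toReal_sub_of_le hq (by simp)]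
    simp only [ENNReal.toReal_natCast, ENNReal.toReal_one, ENNReal.toReal_ofNat]
    have hrank' : (2 : ℝ) * (n + Nat.card (Quotient (MulAction.orbitRel Γ
        (PGL(2, F) ⧸ pgl2Integers F)))) = Nat.card (Quotient (MulAction.orbitRel Γ
        (PGL(2, F) ⧸ pgl2Integers F))) * (Nat.card 𝓀[F] + 1) + 2 := by
      exact_mod_cast hrank
    linarith
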